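/- Let $V_1\cong\mathbb{C}^2$ be the space of complex binary linear forms with the natural action $(g\cdot f)(v)=f(g^{-1}v)$ of $SL_2=SL_2(\mathbb{C})$, let $nV_1$ be the direct sum of $n$ copies of $V_1$, and let $SL_2$ act on $\mathbb{C}^2$ by the standard representation. Let $\mathcal{I}_n=\mathbb{C}[nV_1]^{SL_2}$ and $\mathcal{C}_n=\mathbb{C}[nV_1\oplus\mathbb{C}^2]^{SL_2}$ be the algebras of joint invariants and of joint covariants of $n$ binary linear forms. Let $(\mathcal{I}_n)_j$ and $(\mathcal{C}_n)_j$ be the subspaces of elements that are homogeneous of degree $j$ in the coefficients of the $n$ forms (for covariants, the degree in the coordinates of $\mathbb{C}^2$ is not counted). For every $n\ge 0$ all these subspaces are finite-dimensional, and the Poincaré series $$\mathcal{P}(\mathcal{I}_n,z)=\sum_{j\ge 0}\dim(\mathcal{I}_n)_j\,z^j,\qquad \mathcal{P}(\mathcal{C}_n,z)=\sum_{j\ge 0}\dim(\mathcal{C}_n)_j\,z^j$$ satisfy the following identities of formal power series, where $$N_m(z)=\sum_{k=1}^{m}\frac1k\binom{m-1}{k-1}\binom{m}{k-1}z^{k-1},\qquad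 W_m(z)=\sum_{k=0}^{m}\binom{m}{k}^2z^k$$ are the Narayana polynomials and the Narayana polynomials of type B. (i) For every integer $n\ge 3$, $$\mathcal{P}(\mathcal{I}_n,z)=\frac{\sum_{k=1}^{n-2}\frac1k\binom{n-3}{k-1}\binom{n-2}{k-1}z^{2k-2}}{(1-z^2)^{2n-3}}=\frac{N_{n-2}(z^2)}{(1-z^2)^{2n-3}}.$$ (ii) For every integer $n\ge 2$, $$\mathcal{P}(\mathcal{C}_n,z)=\frac{\sum_{k=0}^{n-1}\binom{n-1}{k}^2z^{2k}+\sum_{k=0}^{n-2}\binom{n-2}{k}\binom{n}{k+1}z^{2k+1}}{(1-z^2)^{2n-1}}=\frac{W_{n-1}(z^2)+n\,z\,N_{n-1}(z^2)}{(1-z^2)^{2n-1}}.$$ -/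

import Mathlib

open scoped Matrix MatrixGroups

noncomputable section

namespace BinaryForms

/-- A binary linear form `a 0 * x + a 1 * y`, recorded by its pair of coefficients. The space
`V₁` of binary linear forms is the space of these pairs. -/
abbrev LinearForm : Type := Fin 2 → ℂ

/-- The value of the binary linear form `a` at the vector `v`. -/
def LinearForm.value (a : LinearForm) (v : Fin 2 → ℂ) : ℂ := a ⬝ᵥ v

/-- The natural action of `SL₂(ℂ)` on linear forms, `(g • f)(v) = f (g⁻¹ v)`, on coefficients. -/
def LinearForm.act (g : SL(2, ℂ)) (a : LinearForm) : LinearForm :=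
  a ᵥ* ((g⁻¹ : SL(2, ℂ)) : Matrix (Fin 2) (Fin 2) ℂ)

/-- `LinearForm.act` is the action by inverse substitution. -/
theorem LinearForm.value_act (g : SL(2, ℂ)) (a : LinearForm) (v : Fin 2 → ℂ) :
    (a.act g).value v = a.value (((g⁻¹ : SL(2, ℂ)) : Matrix (Fin 2) (Fin 2) ℂ) *ᵥ v) := by
  simp only [LinearForm.value, LinearForm.act, Matrix.dotProduct_mulVec]

/-- The value of a polynomial `F ∈ ℂ[n V₁]` at an `n`-tuple of linear forms; the variable `(i, s)`
is the `s`-th coefficient of the `i`-th form. -/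
def evalForms {n : ℕ} (f : Fin n → LinearForm) (F : MvPolynomial (Fin n × Fin 2) ℂ) : ℂ :=
  MvPolynomial.eval (fun p => f p.1 p.2) F

/-- The value of a polynomial `F ∈ ℂ[n V₁ ⊕ ℂ²]` at an `n`-tuple of linear forms and a vector. -/
def evalFormsVec {n : ℕ} (f : Fin n → LinearForm) (v : Fin 2 → ℂ)
    (F : MvPolynomial ((Fin n × Fin 2) ⊕ Fin 2) ℂ) : ℂ :=
  MvPolynomial.eval (Sum.elim (fun p => f p.1 p.2) v) F

/-- The algebra `𝓘ₙ = ℂ[n V₁]^{SL₂}` of joint invariants of `n` binary linear forms. -/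
def jointInvariants (n : ℕ) : Subalgebra ℂ (MvPolynomial (Fin n × Fin 2) ℂ) where
  carrier := {F | ∀ (g : SL(2, ℂ)) (f : Fin n → LinearForm),
    evalForms (fun i => (f i).act g) F = evalForms f F}
  mul_mem' := fun hF hG g f => by
    have h1 := hF g f
    have h2 := hG g f
    simp only [evalForms, map_mul] at *
    rw [h1, h2]
  add_mem' := fun hF hG g f => by
    have h1 := hF g f
    have h2 := hG g f
    simp only [evalForms, map_add] at *
    rw [h1, h2]
  algebraMap_mem' := fun c g f => by
    simp [evalForms, MvPolynomial.algebraMap_eq]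

/-- The algebra `𝓒ₙ = ℂ[n V₁ ⊕ ℂ²]^{SL₂}` of joint covariants of `n` binary linear forms, where
`SL₂` acts on `ℂ²` by the standard representation. -/
def jointCovariants (n : ℕ) : Subalgebra ℂ (MvPolynomial ((Fin n × Fin 2) ⊕ Fin 2) ℂ) where
  carrier := {F | ∀ (g : SL(2, ℂ)) (f : Fin n → LinearForm) (v : Fin 2 → ℂ),
    evalFormsVec (fun i => (f i).act g) ((g : Matrix (Fin 2) (Fin 2) ℂ) *ᵥ v) F
      = evalFormsVec f v F}
  mul_mem' := fun hF hG g f v => by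
    have h1 := hF g f v
    have h2 := hG g f v
    simp only [evalFormsVec, map_mul] at *
    rw [h1, h2]
  add_mem' := fun hF hG g f v => by
    have h1 := hF g f v
    have h2 := hG g f v
    simp only [evalFormsVec, map_add] at *
    rw [h1, h2]
  algebraMap_mem' := fun c g f v => by
    simp [evalFormsVec, MvPolynomial.algebraMap_eq]

/-- The component `(𝓘ₙ)ⱼ` of joint invariants that are homogeneous of degree `j`. -/
def invariantsOfDegree (n j : ℕ) : Submodule ℂ (MvPolynomial (Fin n × Fin 2) ℂ) :=
  Subalgebra.toSubmodule (jointInvariants n) ⊓ MvPolynomial.homogeneousSubmodule (Fin n × Fin 2) ℂ j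

/-- The component `(𝓒ₙ)ⱼ` of joint covariants of degree `j`. The degree of a covariant is its
degree in the coefficients of the forms; the degree in the two coordinates of `ℂ²` is its order,
which does not count (weight `0`). -/
def covariantsOfDegree (n j : ℕ) : Submodule ℂ (MvPolynomial ((Fin n × Fin 2) ⊕ Fin 2) ℂ) :=
  Subalgebra.toSubmodule (jointCovariants n) ⊓
    MvPolynomial.weightedHomogeneousSubmodule ℂ
      (Sum.elim (fun _ => 1) (fun _ => 0) : (Fin n × Fin 2) ⊕ Fin 2 → ℕ) j

/-- The Poincaré series `∑ⱼ dim (Aⱼ) zʲ` of a sequence of (finite-dimensional) components. -/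
def poincareSeries {M : Type} [AddCommGroup M] [Module ℂ M] (A : ℕ → Submodule ℂ M) :
    PowerSeries ℚ :=
  PowerSeries.mk fun j => (Module.finrank ℂ (A j) : ℚ)

/-- The Narayana polynomial `Nₙ`. -/
def narayana (n : ℕ) : Polynomial ℚ :=
  ∑ k ∈ Finset.Icc 1 n,
    Polynomial.C ((1 / (k : ℚ)) * ((n - 1).choose (k - 1) : ℚ) * (n.choose (k - 1) : ℚ)) *
      Polynomial.X ^ (k - 1)

/-- The Narayana polynomial `Wₙ` of type B. -/
def narayanaB (n : ℕ) : Polynomial ℚ :=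
  ∑ k ∈ Finset.range (n + 1), Polynomial.C ((n.choose k : ℚ) ^ 2) * Polynomial.X ^ k

/-- The formal power series `p(z²)`. -/
def evalSq (p : Polynomial ℚ) : PowerSeries ℚ :=
  Polynomial.aeval ((PowerSeries.X : PowerSeries ℚ) ^ 2) p

end BinaryForms

end

/-!
A polynomial in the entries of an `n × 2` matrix is invariant under `SL₂` if and only if it is
killed by the two nilpotent polarization operators, because transvections generate `SL₂`. These
operators form an `𝔰𝔩₂`-triple and preserve the degree in every row, so by the representation theory
of `𝔰𝔩₂` the dimension of the space of invariants with given row degrees is the number of monomials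
of weight `0` minus the number of monomials of weight `2`. A covariant of `n` linear forms is an
invariant of `n + 1` of them: a vector `v` stands for the linear form `det (v, ·)`. The generating
functions of the dimensions are hypergeometric series `₂F₁(a, b; c)` in `z²` with `c = 2` for
invariants and `c = 1` for the covariants of even degree; Euler's transformation turns them into a
Narayana polynomial over a power of `1 - z²`.
-/

namespace BinaryForms

section EulerTransformation

open PowerSeries

theorem succ_mul_multichoose_succ (n k : ℕ) :
    (k + 1) * n.multichoose (k + 1) = (n + k) * n.multichoose k := by
  cases n with
  | zero => cases k <;> simp
  | succ m =>
    rw [Nat.multichoose_eq, Nat.multichoose_eq, show m + 1 + (k + 1) - 1 = m + k + 1 by omega,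
      show m + 1 + k - 1 = m + k by omega, mul_comm, ← Nat.add_one_mul_choose_eq]
    ring

theorem mul_multichoose_succ_left (n k : ℕ) :
    n * (n + 1).multichoose k = (n + k) * n.multichoose k := by
  induction k with
  | zero => simp
  | succ k ih =>
    rw [Nat.multichoose_succ_succ, mul_add, ih, ← succ_mul_multichoose_succ]
    ring

theorem multichoose_pos {n : ℕ} (hn : 0 < n) (k : ℕ) : 0 < n.multichoose k := by
  rw [Nat.multichoose_eq]
  exact Nat.choose_pos (by omega)

theorem succ_mul_cast_choose_succ (R : Type*) [CommRing R] (n k : ℕ) :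
    ((k : R) + 1) * n.choose (k + 1) = (n - k) * n.choose k := by
  have h := congrArg (Nat.cast (R := R)) (Nat.add_one_mul_choose_eq n k)
  rw [Nat.choose_succ_succ] at h
  push_cast at h
  linear_combination -h

theorem mk_multichoose_mul_one_sub_X_pow (R : Type*) [CommRing R] (n : ℕ) :
    mk (fun k => (n.multichoose k : R)) * (1 - X) ^ n = 1 := by
  induction n with
  | zero =>
    ext k
    cases k <;> simp [coeff_one]
  | succ n ih =>
    have pascal : mk (fun k => ((n + 1).multichoose k : R)) * (1 - X) =
        mk fun k => (n.multichoose k : R) := by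
      ext k
      cases k <;> simp [mul_sub, coeff_succ_mul_X, Nat.multichoose_succ_succ]
    rw [pow_succ', ← mul_assoc, pascal, ih]

theorem coeff_X_mul_derivative {R : Type*} [CommRing R] (F : R⟦X⟧) (k : ℕ) :
    coeff k (X * d⁄dX R F) = k * coeff k F := by
  cases k <;> simp [coeff_succ_X_mul, coeff_derivative, mul_comm]

theorem X_mul_derivative_add_mul_one_sub_X_pow {R : Type*} [CommRing R] (F : R⟦X⟧) (c : R)
    (N : ℕ) :
    (X * d⁄dX R F + C c * F) * (1 - X) ^ (N + 1) =
      (1 - X) * (X * d⁄dX R (F * (1 - X) ^ N) + C c * (F * (1 - X) ^ N)) +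
        (N : R⟦X⟧) * X * (F * (1 - X) ^ N) := by
  have hderiv : d⁄dX R (F * (1 - X) ^ N) * (1 - X) =
      d⁄dX R F * (1 - X) ^ (N + 1) - (N : R⟦X⟧) * (F * (1 - X) ^ N) := by
    rw [Derivation.leibniz, Derivation.leibniz_pow, map_sub, derivative_X,
      Derivation.map_one_eq_zero]
    cases N with
    | zero => simp [mul_comm]
    | succ N => simp only [smul_eq_mul, nsmul_eq_mul, Nat.add_sub_cancel]; ring
  linear_combination -X * hderiv

theorem coeff_succ_one_sub_X_mul_derivative_add {R : Type*} [CommRing R] (F : R⟦X⟧) (c : R)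
    (N k : ℕ) :
    coeff (k + 1) ((1 - X) * (X * d⁄dX R F + C c * F) + (N : R⟦X⟧) * X * F) =
      (k + 1 + c) * coeff (k + 1) F + (N - c - k) * coeff k F := by
  rw [← map_natCast C N, sub_mul, one_mul, mul_assoc, map_add, map_sub, map_add,
    coeff_X_mul_derivative, coeff_succ_X_mul, map_add, coeff_X_mul_derivative, coeff_C_mul,
    coeff_C_mul, coeff_C_mul, coeff_succ_X_mul]
  push_cast
  ring

variable {K : Type*} [Field K] [CharZero K]

theorem C_mul_mk_multichoose_succ {c : ℕ} (hc : 0 < c) (a b : ℕ) :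
    C ((b + c : ℕ) : K) *
        mk (fun k => (a + c).multichoose k * (b + 1 + c).multichoose k / (c.multichoose k : K)) =
      X * d⁄dX K (mk fun k =>
          (a + c).multichoose k * (b + c).multichoose k / (c.multichoose k : K)) +
        C ((b + c : ℕ) : K) * mk fun k =>
          (a + c).multichoose k * (b + c).multichoose k / (c.multichoose k : K) := by
  ext k
  have hmc : (c.multichoose k : K) ≠ 0 := mod_cast (multichoose_pos hc k).ne'
  have h := congrArg (Nat.cast (R := K)) (mul_multichoose_succ_left (b + c) k)
  rw [map_add, coeff_C_mul, coeff_C_mul, coeff_X_mul_derivative, coeff_mk, coeff_mk,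
    Nat.add_right_comm b 1]
  push_cast at h ⊢
  field_simp
  linear_combination ((a + c).multichoose k : K) * h

theorem choose_mul_choose_div_multichoose_succ {c : ℕ} (hc : 0 < c) (a b k : ℕ) :
    (k + 1 + (b + c)) *
          (a.choose (k + 1) * b.choose (k + 1) / (c.multichoose (k + 1) : K)) +
        (a - k) * (a.choose k * b.choose k / (c.multichoose k : K)) =
      (b + c) * (a.choose (k + 1) * (b + 1).choose (k + 1) / (c.multichoose (k + 1) : K)) := by
  have ha := succ_mul_cast_choose_succ K a k
  have hb := succ_mul_cast_choose_succ K b k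
  have hdiv : ((k : K) + 1) / c.multichoose k = (c + k) / c.multichoose (k + 1) := by
    have hmc (l : ℕ) : (c.multichoose l : K) ≠ 0 := mod_cast (multichoose_pos hc l).ne'
    rw [div_eq_div_iff (hmc k) (hmc (k + 1))]
    exact_mod_cast succ_mul_multichoose_succ c k
  rw [Nat.choose_succ_succ b]
  push_cast
  linear_combination (-(b.choose k : K) / c.multichoose k) * ha +
    (a.choose (k + 1) : K) * b.choose k * hdiv +
    ((a.choose (k + 1) : K) / c.multichoose (k + 1)) * hb

/-- Euler's transformation `₂F₁(a + c, b + c; c) = (1 - X)^(-a-b-c) ₂F₁(-a, -b; c)`. -/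
theorem mk_multichoose_mul_one_sub_X_pow_eq_mk_choose {c : ℕ} (hc : 0 < c) (a b : ℕ) :
    mk (fun k => (a + c).multichoose k * (b + c).multichoose k / (c.multichoose k : K)) *
        (1 - X) ^ (a + b + c) =
      mk fun k => a.choose k * b.choose k / (c.multichoose k : K) := by
  induction b with
  | zero =>
    have hmc (k : ℕ) : (c.multichoose k : K) ≠ 0 := mod_cast (multichoose_pos hc k).ne'
    simp only [zero_add, mul_div_cancel_right₀ _ (hmc _), add_zero,
      mk_multichoose_mul_one_sub_X_pow]
    ext k
    cases k <;> simp [coeff_one]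
  | succ b ih =>
    have hbc : C ((b + c : ℕ) : K) ≠ 0 := by
      rw [ne_eq, map_eq_zero_iff _ C_injective, Nat.cast_eq_zero]
      omega
    refine mul_left_cancel₀ hbc ?_
    rw [← mul_assoc, C_mul_mk_multichoose_succ hc, ← add_assoc, add_right_comm _ 1,
      X_mul_derivative_add_mul_one_sub_X_pow, ih]
    ext k
    cases k with
    | zero => simp
    | succ k =>
      rw [coeff_succ_one_sub_X_mul_derivative_add, coeff_C_mul, coeff_mk, coeff_mk, coeff_mk]
      push_cast
      rw [← choose_mul_choose_div_multichoose_succ hc]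
      ring

end EulerTransformation

section Sl2

open Module (End finrank)
open LieModule (toEnd toEnd_apply_apply)

variable {K L M : Type*} [Field K] [LieRing L] [LieAlgebra K L] [AddCommGroup M] [Module K M]
  [LieRingModule L M] [LieModule K L M] {h e f : L}

theorem lie_h_lie_e (t : IsSl2Triple h e f) {μ : K} {v : M} (hv : ⁅h, v⁆ = μ • v) :
    ⁅h, ⁅e, v⁆⁆ = (μ + 2) • ⁅e, v⁆ := by
  rw [leibniz_lie, t.lie_h_e_smul K, smul_lie, hv, lie_smul, add_comm, add_smul]

theorem lie_h_lie_f (t : IsSl2Triple h e f) {μ : K} {v : M} (hv : ⁅h, v⁆ = μ • v) :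
    ⁅h, ⁅f, v⁆⁆ = (μ - 2) • ⁅f, v⁆ := by
  rw [leibniz_lie, t.lie_lie_smul_f K, neg_lie, smul_lie, hv, lie_smul, sub_smul, sub_eq_neg_add]

variable [CharZero K] {N : Submodule K M} [FiniteDimensional K N]

theorem exists_toEnd_e_pow_eq_zero (t : IsSl2Triple h e f) (he : ∀ v ∈ N, ⁅e, v⁆ ∈ N) {μ : K}
    {v : M} (hvN : v ∈ N) (hv : ⁅h, v⁆ = μ • v) : ∃ k, (toEnd K L M e ^ k) v = 0 := by
  by_contra! hne
  have hmem (k : ℕ) : (toEnd K L M e ^ k) v ∈ N ∧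
      ⁅h, (toEnd K L M e ^ k) v⁆ = (μ + 2 * k) • (toEnd K L M e ^ k) v := by
    induction k with
    | zero => simpa using ⟨hvN, hv⟩
    | succ k ih =>
      rw [pow_succ', End.mul_apply, toEnd_apply_apply]
      refine ⟨he _ ih.1, ?_⟩
      rw [lie_h_lie_e t ih.2]
      push_cast
      ring_nf
  have hindep : LinearIndependent K fun k : ℕ => (toEnd K L M e ^ k) v :=
    End.eigenvectors_linearIndependent' (toEnd K L M h) (fun k : ℕ => μ + 2 * k)
      (fun k l hkl => by simpa using hkl) _
      fun k => ⟨End.mem_eigenspace_iff.2 (hmem k).2, hne k⟩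
  have hindepN : LinearIndependent K fun k : ℕ => (⟨_, (hmem k).1⟩ : N) :=
    .of_comp N.subtype hindep
  have := hindepN.finite
  exact not_finite ℕ

theorem eq_zero_of_lie_e_lie_f_add_smul_eq_zero (t : IsSl2Triple h e f) {k m c : ℕ} (hm : 0 < m)
    {v : M} (hv : ⁅h, v⁆ = (m : K) • v) (hk : (toEnd K L M e ^ k) v = 0)
    (hef : ⁅e, ⁅f, v⁆⁆ + (c : K) • v = 0) : v = 0 := by
  induction k generalizing m c v with
  | zero => simpa using hk
  | succ k ih =>
    have hfe : ⁅f, ⁅e, v⁆⁆ + ((m + c : ℕ) : K) • v = 0 := by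
      rw [← hef, leibniz_lie e f, t.lie_e_f, hv, Nat.cast_add, add_smul]
      abel
    have hev : ⁅e, v⁆ = 0 := by
      refine ih (m := m + 2) (c := m + c) (by omega) ?_ ?_ ?_
      · exact_mod_cast lie_h_lie_e t hv
      · rw [← hk, pow_succ, End.mul_apply, toEnd_apply_apply]
      · rw [← lie_smul, ← lie_add, hfe, lie_zero]
    rw [hev, lie_zero, zero_add, smul_eq_zero, Nat.cast_eq_zero] at hfe
    exact hfe.resolve_left (by omega)

theorem eq_zero_of_lie_e_lie_f_eq_zero (t : IsSl2Triple h e f) (he : ∀ v ∈ N, ⁅e, v⁆ ∈ N) {m : ℕ}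
    (hm : 0 < m) {v : M} (hvN : v ∈ N) (hv : ⁅h, v⁆ = (m : K) • v) (hef : ⁅e, ⁅f, v⁆⁆ = 0) :
    v = 0 := by
  obtain ⟨k, hk⟩ := exists_toEnd_e_pow_eq_zero t he hvN hv
  exact eq_zero_of_lie_e_lie_f_add_smul_eq_zero t (c := 0) hm hv hk (by simpa using hef)

variable (K) in
theorem lie_f_eq_zero_of_lie_e_eq_zero (t : IsSl2Triple h e f) (hf : ∀ v ∈ N, ⁅f, v⁆ ∈ N)
    {v : M} (hvN : v ∈ N) (hv : ⁅h, v⁆ = 0) (hev : ⁅e, v⁆ = 0) : ⁅f, v⁆ = 0 := by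
  rw [← zero_smul K v] at hv
  have hef : ⁅e, ⁅f, v⁆⁆ = 0 := by
    rw [leibniz_lie, t.lie_e_f, hv, hev, lie_zero, zero_smul, add_zero]
  refine eq_zero_of_lie_e_lie_f_eq_zero t.symm hf two_pos (hf v hvN) ?_ (by rw [hef, lie_zero])
  rw [neg_lie, lie_h_lie_f t hv, zero_sub, neg_smul, neg_neg, Nat.cast_ofNat]

theorem exists_lie_e_eq (t : IsSl2Triple h e f) (he : ∀ v ∈ N, ⁅e, v⁆ ∈ N)
    (hf : ∀ v ∈ N, ⁅f, v⁆ ∈ N) {w : M} (hwN : w ∈ N) (hw : ⁅h, w⁆ = (2 : K) • w) :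
    ∃ v ∈ N, ⁅h, v⁆ = 0 ∧ ⁅e, v⁆ = w := by
  have hlie_f {v : M} (hv : ⁅h, v⁆ = (2 : K) • v) : ⁅h, ⁅f, v⁆⁆ = 0 := by
    rw [lie_h_lie_f t hv, sub_self, zero_smul]
  let W := N ⊓ (toEnd K L M h).eigenspace 2
  let T : End K W := (toEnd K L M e ∘ₗ toEnd K L M f).restrict fun v hv =>
    ⟨he _ (hf v hv.1), End.mem_eigenspace_iff.2 <| by
      have := lie_h_lie_e t ((hlie_f (End.mem_eigenspace_iff.1 hv.2)).trans (zero_smul K _).symm)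
      rwa [zero_add] at this⟩
  have hT : Function.Injective T := by
    rw [← LinearMap.ker_eq_bot, LinearMap.ker_eq_bot']
    intro v hv
    exact Subtype.ext (eq_zero_of_lie_e_lie_f_eq_zero t he two_pos v.2.1
      (End.mem_eigenspace_iff.1 v.2.2) (congrArg Subtype.val hv))
  obtain ⟨v, hv⟩ := LinearMap.injective_iff_surjective.1 hT ⟨w, hwN, End.mem_eigenspace_iff.2 hw⟩
  exact ⟨⁅f, (v : M)⁆, hf _ v.2.1, hlie_f (End.mem_eigenspace_iff.1 v.2.2),
    congrArg Subtype.val hv⟩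

theorem finrank_ker_inf_ker_add_finrank_eigenspace_two (t : IsSl2Triple h e f)
    (he : ∀ v ∈ N, ⁅e, v⁆ ∈ N) (hf : ∀ v ∈ N, ⁅f, v⁆ ∈ N) :
    finrank K ↥((toEnd K L M e).ker ⊓ (toEnd K L M f).ker ⊓ N) +
        finrank K ↥((toEnd K L M h).eigenspace 2 ⊓ N) =
      finrank K ↥((toEnd K L M h).eigenspace 0 ⊓ N) := by
  have hmem {v : M} {μ : K} : v ∈ (toEnd K L M h).eigenspace μ ↔ ⁅h, v⁆ = μ • v :=
    End.mem_eigenspace_iff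
  let T : ↥((toEnd K L M h).eigenspace 0 ⊓ N) →ₗ[K] ↥((toEnd K L M h).eigenspace 2 ⊓ N) :=
    (toEnd K L M e).restrict fun v hv =>
      ⟨hmem.2 (by simpa using lie_h_lie_e t (hmem.1 hv.1)), he v hv.2⟩
  have hrange : T.range = ⊤ := by
    rw [LinearMap.range_eq_top]
    rintro ⟨w, hw, hwN⟩
    obtain ⟨v, hvN, hv, rfl⟩ := exists_lie_e_eq t he hf hwN (hmem.1 hw)
    exact ⟨⟨v, hmem.2 (by rwa [zero_smul]), hvN⟩, rfl⟩
  have hker : T.ker.map (Submodule.subtype _) =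
      (toEnd K L M e).ker ⊓ (toEnd K L M f).ker ⊓ N := by
    ext v
    constructor
    · rintro ⟨⟨v, hv, hvN⟩, hTv, rfl⟩
      have hev : ⁅e, v⁆ = 0 := congrArg Subtype.val hTv
      rw [SetLike.mem_coe, hmem, zero_smul] at hv
      exact ⟨⟨hev, lie_f_eq_zero_of_lie_e_eq_zero K t hf hvN hv hev⟩, hvN⟩
    · rintro ⟨⟨hev, hfv⟩, hvN⟩
      have hv : ⁅h, v⁆ = (0 : K) • v := by
        rw [← t.lie_e_f, lie_lie]
        simp_all
      exact ⟨⟨v, hmem.2 hv, hvN⟩, Subtype.ext hev, rfl⟩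
  rw [← LinearMap.finrank_range_add_finrank_ker T, hrange, finrank_top, ← hker, add_comm,
    LinearEquiv.finrank_eq (Submodule.equivMapOfInjective _ (Submodule.subtype_injective _) T.ker)]

end Sl2

section Derivations

open MvPolynomial

variable {τ R : Type*} [CommRing R] {D : Derivation R (MvPolynomial τ R) (MvPolynomial τ R)}

variable (D) in
theorem derivation_monomial (s : τ →₀ ℕ) (r : R) :
    D (monomial s r) = s.sum fun i k => monomial (s - Finsupp.single i 1) (r * k) * D (X i) := by
  have hD : D = mkDerivation R fun i => D (X i) :=
    derivation_ext fun i => (mkDerivation_X R (fun i => D (X i)) i).symm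
  conv_lhs => rw [hD]
  rw [mkDerivation_monomial, Finsupp.smul_sum]
  refine Finsupp.sum_congr fun i _ => ?_
  rw [← smul_assoc, smul_monomial, smul_eq_mul, smul_eq_mul]

theorem coeff_derivation_of_forall_X_eq_smul {w : τ → R} (hD : ∀ i, D (X i) = w i • X i)
    (d : τ →₀ ℕ) (F : MvPolynomial τ R) : coeff d (D F) = Finsupp.weight w d * coeff d F := by
  classical
  have hmonomial (s : τ →₀ ℕ) (r : R) : D (monomial s r) = Finsupp.weight w s • monomial s r := by
    rw [derivation_monomial, Finsupp.weight_apply, Finsupp.sum, Finsupp.sum, Finset.sum_smul]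
    refine Finset.sum_congr rfl fun i hi => ?_
    rw [hD, mul_smul_comm, X, monomial_mul,
      Finsupp.sub_single_one_add (Finsupp.mem_support_iff.1 hi), smul_monomial, smul_monomial]
    simp [mul_comm, mul_left_comm]
  induction F using MvPolynomial.induction_on' with
  | monomial s r =>
    rw [hmonomial, coeff_smul, coeff_monomial, smul_eq_mul]
    split_ifs with h
    · rw [h]
    · rw [mul_zero, mul_zero]
  | add p q hp hq => rw [map_add, coeff_add, coeff_add, hp, hq, mul_add]

theorem derivation_mem_restrictSupport {M : Type*} [AddCommMonoid M] {w : τ → M}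
    (hD : ∀ i, IsWeightedHomogeneous w (D (X i)) (w i)) {T : Set M} {F : MvPolynomial τ R}
    (hF : F ∈ restrictSupport R (Finsupp.weight w ⁻¹' T)) :
    D F ∈ restrictSupport R (Finsupp.weight w ⁻¹' T) := by
  have hmonomial (s : τ →₀ ℕ) (r : R) :
      IsWeightedHomogeneous w (D (monomial s r)) (Finsupp.weight w s) := by
    rw [derivation_monomial]
    refine IsWeightedHomogeneous.sum _ _ _ fun i hi => ?_
    rw [← Finsupp.weight_sub_single_add (Finsupp.mem_support_iff.1 hi)]
    exact (isWeightedHomogeneous_monomial _ _ _ rfl).mul (hD i)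
  rw [F.as_sum, map_sum]
  refine Submodule.sum_mem _ fun s hs d hd => ?_
  rw [Set.mem_preimage, hmonomial s _ (mem_support_iff.1 hd)]
  exact hF hs

theorem eigenspace_derivation_of_forall_X_eq_smul [IsDomain R] {w : τ → R}
    (hD : ∀ i, D (X i) = w i • X i) (μ : R) :
    Module.End.eigenspace (D : MvPolynomial τ R →ₗ[R] MvPolynomial τ R) μ =
      restrictSupport R {d | Finsupp.weight w d = μ} := by
  ext F
  rw [Module.End.mem_eigenspace_iff, MvPolynomial.ext_iff, mem_restrictSupport_iff]
  refine forall_congr' fun d => ?_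
  rw [Finset.mem_coe, mem_support_iff, Derivation.coeFn_coe,
    coeff_derivation_of_forall_X_eq_smul hD, coeff_smul, smul_eq_mul, mul_eq_mul_right_iff,
    or_iff_not_imp_right, Set.mem_ofPred_eq]

theorem finite_restrictSupport {S : Set (τ →₀ ℕ)} (hS : S.Finite) :
    Module.Finite R (restrictSupport R S) :=
  have := hS.to_subtype
  .of_basis (basisRestrictSupport R S)

theorem finrank_restrictSupport [Nontrivial R] (S : Set (τ →₀ ℕ)) :
    Module.finrank R (restrictSupport R S) = S.ncard :=
  (Module.finrank_eq_nat_card_basis (basisRestrictSupport R S)).trans (Nat.card_coe_set_eq S)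

end Derivations

noncomputable section Polarization

open MvPolynomial Module

variable {σ ι K : Type*}

variable (σ K) in
/-- The polarization operator `∑ i, x i a ∂ / ∂ (x i b)` on polynomials in the entries of a matrix
`x` with rows indexed by `σ`. For `ι = Fin 2` these operators span the infinitesimal action of
`𝔤𝔩₂`. -/
def polarization [CommRing K] [DecidableEq ι] (a b : ι) :
    Derivation K (MvPolynomial (σ × ι) K) (MvPolynomial (σ × ι) K) :=
  mkDerivation K fun p => if p.2 = b then X (p.1, a) else 0

variable (σ K) in
/-- The polynomials in the entries of a `σ × Fin 2` matrix killed by the infinitesimal right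
multiplication by `𝔰𝔩₂`, which is generated by its two nilpotent basis elements. -/
def sl2Invariants [CommRing K] : Submodule K (MvPolynomial (σ × Fin 2) K) :=
  LinearMap.ker (polarization σ K 0 1).toLinearMap ⊓
    LinearMap.ker (polarization σ K 1 0).toLinearMap

variable (σ K) in
/-- The operator on the polynomials in the entries of a `σ × Fin 2` matrix which multiplies a
monomial by its degree in the first column minus its degree in the second one: the neutral element
of the `𝔰𝔩₂`-triple of polarization operators. -/
def cartanOperator [CommRing K] :
    Derivation K (MvPolynomial (σ × Fin 2) K) (MvPolynomial (σ × Fin 2) K) :=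
  polarization σ K 0 0 - polarization σ K 1 1

/-- The multidegree of a monomial in the entries of a matrix: its degree in each row. -/
def rowDegree : (σ × ι →₀ ℕ) →+ (σ →₀ ℕ) := Finsupp.weight fun p => Finsupp.single p.1 1

variable (σ) in
/-- The exponents of the two columns of a `σ × Fin 2` matrix of variables. -/
def exponentEquiv : (σ × Fin 2 →₀ ℕ) ≃+ (σ →₀ ℕ) × (σ →₀ ℕ) :=
  (Finsupp.domCongr (((Equiv.refl σ).prodCongr finTwoEquiv).trans
    ((Equiv.prodComm σ Bool).trans (Equiv.boolProdEquivSum σ)))).trans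
    Finsupp.sumFinsuppAddEquivProdFinsupp

section CommRing

variable [CommRing K]

theorem polarization_X [DecidableEq ι] (a b : ι) (p : σ × ι) :
    polarization σ K a b (X p) = if p.2 = b then X (p.1, a) else 0 :=
  mkDerivation_X K _ p

theorem lie_polarization [DecidableEq ι] (a b c d : ι) :
    ⁅polarization σ K a b, polarization σ K c d⁆ =
      (if c = b then polarization σ K a d else 0) - if a = d then polarization σ K c b else 0 := by
  refine derivation_ext fun p => ?_
  rw [Derivation.commutator_apply, Derivation.sub_apply, polarization_X, polarization_X]
  split_ifs <;> simp_all [polarization_X]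

theorem isWeightedHomogeneous_polarization_X [DecidableEq ι] (a b : ι) (p : σ × ι) :
    IsWeightedHomogeneous (fun p : σ × ι => Finsupp.single p.1 1)
      (polarization σ K a b (X p)) (Finsupp.single p.1 1) := by
  rw [polarization_X]
  split_ifs
  · exact isWeightedHomogeneous_X K _ (p.1, a)
  · exact isWeightedHomogeneous_zero K _ _

theorem polarization_mem_restrictSupport [DecidableEq ι] (a b : ι) {T : Set (σ →₀ ℕ)}
    {F : MvPolynomial (σ × ι) K} (hF : F ∈ restrictSupport K (rowDegree ⁻¹' T)) :
    polarization σ K a b F ∈ restrictSupport K (rowDegree ⁻¹' T) :=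
  derivation_mem_restrictSupport (isWeightedHomogeneous_polarization_X a b) hF

theorem cartanOperator_X (p : σ × Fin 2) :
    cartanOperator σ K (X p) = (![1, -1] p.2 : K) • X p := by
  obtain ⟨i, b⟩ := p
  fin_cases b <;> simp [cartanOperator, polarization_X]

theorem isSl2Triple_polarization [Nontrivial K] [Nonempty σ] :
    IsSl2Triple (cartanOperator σ K) (polarization σ K 0 1) (polarization σ K 1 0) where
  h_ne_zero h := by
    obtain ⟨i⟩ := ‹Nonempty σ›
    have hX := cartanOperator_X (K := K) (i, 0)
    rw [h, Derivation.zero_apply] at hX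
    exact X_ne_zero (R := K) (i, 0) (by simpa using hX.symm)
  lie_e_f := by simp [cartanOperator, lie_polarization]
  lie_h_e_nsmul := by simp [cartanOperator, lie_polarization, two_nsmul]
  lie_h_f_nsmul := by simp [cartanOperator, lie_polarization, two_nsmul, sub_eq_add_neg]

end CommRing

theorem exponentEquiv_single_zero (i : σ) (k : ℕ) :
    exponentEquiv σ (Finsupp.single (i, 0) k) = (Finsupp.single i k, 0) := by
  ext j <;> simp [exponentEquiv, finTwoEquiv]

theorem exponentEquiv_single_one (i : σ) (k : ℕ) :
    exponentEquiv σ (Finsupp.single (i, 1) k) = (0, Finsupp.single i k) := by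
  ext j <;> simp [exponentEquiv, finTwoEquiv]

theorem rowDegree_eq_add (d : σ × Fin 2 →₀ ℕ) :
    rowDegree d = (exponentEquiv σ d).1 + (exponentEquiv σ d).2 := by
  induction d using Finsupp.induction_linear with
  | zero => simp
  | add d d' hd hd' => rw [map_add, map_add, hd, hd', Prod.fst_add, Prod.snd_add]; abel
  | single p k =>
    obtain ⟨i, b⟩ := p
    fin_cases b <;>
      simp [rowDegree, Finsupp.weight_single, exponentEquiv_single_zero, exponentEquiv_single_one]

theorem weight_one_neg_one [CommRing K] (d : σ × Fin 2 →₀ ℕ) :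
    Finsupp.weight (fun p : σ × Fin 2 => (![1, -1] p.2 : K)) d =
      (exponentEquiv σ d).1.degree - (exponentEquiv σ d).2.degree := by
  induction d using Finsupp.induction_linear with
  | zero => simp
  | add d d' hd hd' =>
    simp only [map_add, Prod.fst_add, Prod.snd_add, hd, hd', Nat.cast_add]
    abel
  | single p k =>
    obtain ⟨i, b⟩ := p
    fin_cases b <;>
      simp [Finsupp.weight_single, exponentEquiv_single_zero, exponentEquiv_single_one]

theorem finite_setOf_fst_add_snd_mem {T : Set (σ →₀ ℕ)} (hT : T.Finite) :
    {p : (σ →₀ ℕ) × (σ →₀ ℕ) | p.1 + p.2 ∈ T}.Finite := by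
  classical
  exact (hT.biUnion fun t _ => (Finset.HasAntidiagonal.antidiagonal t).finite_toSet).subset
    fun p hp => Set.mem_biUnion (x := p.1 + p.2) hp (by simp)

theorem finite_rowDegree_preimage {T : Set (σ →₀ ℕ)} (hT : T.Finite) :
    (rowDegree (ι := Fin 2) ⁻¹' T).Finite := by
  refine ((finite_setOf_fst_add_snd_mem hT).preimage (exponentEquiv σ).injective.injOn).subset
    fun d hd => ?_
  rwa [Set.mem_preimage, rowDegree_eq_add] at hd

variable [Field K]

theorem finrank_restrictSupport_preimage_exponentEquiv (S : Set ((σ →₀ ℕ) × (σ →₀ ℕ))) :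
    finrank K (restrictSupport K (exponentEquiv σ ⁻¹' S)) = S.ncard := by
  rw [finrank_restrictSupport, Set.ncard_preimage_of_injective_subset_range
    (exponentEquiv σ).injective (by simp)]

variable [CharZero K]

theorem eigenspace_inf_restrictSupport (k : ℕ) (T : Set (σ →₀ ℕ)) :
    End.eigenspace (cartanOperator σ K).toLinearMap (k : K) ⊓
        restrictSupport K (rowDegree ⁻¹' T) =
      restrictSupport K (exponentEquiv σ ⁻¹'
        {p | p.1 + p.2 ∈ T ∧ p.1.degree = p.2.degree + k}) := by
  rw [eigenspace_derivation_of_forall_X_eq_smul cartanOperator_X, inf_comm]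
  have hweight (d : σ × Fin 2 →₀ ℕ) :
      Finsupp.weight (fun p : σ × Fin 2 => (![1, -1] p.2 : K)) d = k ↔
        (exponentEquiv σ d).1.degree = (exponentEquiv σ d).2.degree + k := by
    rw [weight_one_neg_one, sub_eq_iff_eq_add']
    exact_mod_cast Iff.rfl
  ext F
  simp only [Submodule.mem_inf, mem_restrictSupport_iff, ← Set.subset_inter_iff]
  simp only [Set.subset_def, Set.mem_inter_iff, Set.mem_preimage, Set.mem_ofPred_eq,
    rowDegree_eq_add, hweight]

theorem finrank_sl2Invariants_inf_restrictSupport [Nonempty σ] {T : Set (σ →₀ ℕ)}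
    (hT : T.Finite) :
    finrank K ↥(sl2Invariants σ K ⊓ restrictSupport K (rowDegree ⁻¹' T)) +
        {p : (σ →₀ ℕ) × (σ →₀ ℕ) | p.1 + p.2 ∈ T ∧ p.1.degree = p.2.degree + 2}.ncard =
      {p : (σ →₀ ℕ) × (σ →₀ ℕ) | p.1 + p.2 ∈ T ∧ p.1.degree = p.2.degree}.ncard := by
  have := finite_restrictSupport (R := K) (finite_rowDegree_preimage hT)
  have h0 := eigenspace_inf_restrictSupport (K := K) 0 T
  have h2 := eigenspace_inf_restrictSupport (K := K) 2 T
  rw [Nat.cast_zero] at h0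
  rw [Nat.cast_ofNat] at h2
  have h := finrank_ker_inf_ker_add_finrank_eigenspace_two (M := MvPolynomial (σ × Fin 2) K)
    (isSl2Triple_polarization (σ := σ) (K := K)) (N := restrictSupport K (rowDegree ⁻¹' T))
    (fun _ => polarization_mem_restrictSupport 0 1) (fun _ => polarization_mem_restrictSupport 1 0)
  have htoEnd (D : Derivation K (MvPolynomial (σ × Fin 2) K) (MvPolynomial (σ × Fin 2) K)) :
      LieModule.toEnd K _ (MvPolynomial (σ × Fin 2) K) D = D.toLinearMap := rfl
  rw [htoEnd, htoEnd, htoEnd, h0, h2, finrank_restrictSupport_preimage_exponentEquiv,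
    finrank_restrictSupport_preimage_exponentEquiv] at h
  exact h

end Polarization

noncomputable section Substitution

open MvPolynomial

variable {σ ι K : Type*}

section CommRing

variable [CommRing K]

section Generic

variable [DecidableEq ι]

/-- The substitution `x ↦ x * (1 + s E)` with an indeterminate `s`, where `E` is the elementary
matrix at `(a, b)`. -/
def genericTransvection (a b : ι) :
    MvPolynomial (σ × ι) K →ₐ[K] Polynomial (MvPolynomial (σ × ι) K) :=
  aeval fun p => Polynomial.C (X p) + Polynomial.X * Polynomial.C (polarization σ K a b (X p))

theorem genericTransvection_X (a b : ι) (p : σ × ι) :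
    genericTransvection a b (X p) =
      Polynomial.C (X p) + Polynomial.X * Polynomial.C (polarization σ K a b (X p)) :=
  aeval_X _ p

theorem derivative_genericTransvection {a b : ι} (hab : a ≠ b) (F : MvPolynomial (σ × ι) K) :
    (genericTransvection a b F).derivative = genericTransvection a b (polarization σ K a b F) := by
  induction F using MvPolynomial.induction_on with
  | C r => simp [algHom_C]
  | add p q hp hq => simp only [map_add, hp, hq]
  | mul_X p i hp =>
    have hX : genericTransvection a b (polarization σ K a b (X i)) =
        Polynomial.C (polarization σ K a b (X i)) := by
      rw [polarization_X]
      split_ifs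
      · simp [genericTransvection_X, polarization_X, hab]
      · simp
    have hderivX : (genericTransvection a b (X i)).derivative =
        Polynomial.C (polarization σ K a b (X i)) := by
      simp [genericTransvection_X]
    rw [map_mul, Polynomial.derivative_mul, hp, hderivX, Derivation.leibniz, map_add, smul_eq_mul,
      smul_eq_mul, map_mul, map_mul, hX]
    ring

end Generic

variable [Fintype ι]

/-- The substitution `x ↦ x * A` on polynomials in the entries of a `σ × ι` matrix `x`. -/
def substMul (A : Matrix ι ι K) : MvPolynomial (σ × ι) K →ₐ[K] MvPolynomial (σ × ι) K :=
  aeval fun p => ∑ a, A a p.2 • X (p.1, a)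

theorem substMul_X (A : Matrix ι ι K) (p : σ × ι) :
    substMul A (X p) = ∑ a, A a p.2 • X (p.1, a) :=
  aeval_X _ p

theorem substMul_one [DecidableEq ι] (F : MvPolynomial (σ × ι) K) : substMul 1 F = F := by
  refine DFunLike.congr_fun (algHom_ext (g := AlgHom.id K _) fun p => ?_) F
  simp [substMul_X, Matrix.one_apply]

theorem substMul_mul (A B : Matrix ι ι K) (F : MvPolynomial (σ × ι) K) :
    substMul (A * B) F = substMul A (substMul B F) := by
  refine DFunLike.congr_fun (algHom_ext (g := (substMul A).comp (substMul B)) fun p => ?_) F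
  simp only [AlgHom.comp_apply, substMul_X, map_sum, map_smul, Matrix.mul_apply, Finset.sum_smul,
    Finset.smul_sum, smul_smul]
  rw [Finset.sum_comm]
  simp only [mul_comm]

theorem eval_substMul (x : σ × ι → K) (A : Matrix ι ι K) (F : MvPolynomial (σ × ι) K) :
    eval x (substMul A F) = eval (fun p => ((fun a => x (p.1, a)) ᵥ* A) p.2) F := by
  refine DFunLike.congr_fun (ringHom_ext (f := (eval x).comp (substMul A).toRingHom)
    (fun r => ?_) fun p => ?_) F
  · simp [algHom_C]
  · simp [substMul_X, Matrix.vecMul, dotProduct, smul_eval, mul_comm]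

variable [DecidableEq ι]

theorem substMul_transvection_X (a b : ι) (c : K) (p : σ × ι) :
    substMul (Matrix.transvection a b c) (X p) = X p + polarization σ K a b (X p) * C c := by
  rw [substMul_X, polarization_X]
  simp [Matrix.transvection, Matrix.one_apply, Matrix.single_apply, add_smul,
    Finset.sum_add_distrib, ite_and, eq_comm, smul_eq_C_mul, mul_comm]

theorem eval_genericTransvection (a b : ι) (c : K) (F : MvPolynomial (σ × ι) K) :
    (genericTransvection a b F).eval (C c) = substMul (Matrix.transvection a b c) F := by
  induction F using MvPolynomial.induction_on with
  | C r => simp [algHom_C]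
  | add p q hp hq => rw [map_add, map_add, Polynomial.eval_add, hp, hq]
  | mul_X p i hp =>
    rw [map_mul, map_mul, Polynomial.eval_mul, hp, genericTransvection_X, substMul_transvection_X]
    simp

theorem forall_substMul_transvection_eq_self_iff [IsDomain K] [CharZero K] {a b : ι} (hab : a ≠ b)
    {F : MvPolynomial (σ × ι) K} :
    (∀ c, substMul (Matrix.transvection a b c) F = F) ↔ polarization σ K a b F = 0 := by
  have hzero (G : MvPolynomial (σ × ι) K) : (genericTransvection a b G).eval 0 = G := by
    rw [← C_0, eval_genericTransvection, Matrix.transvection_zero, substMul_one]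
  have hderiv := derivative_genericTransvection hab F
  constructor
  · intro h
    have hconst : genericTransvection a b F = Polynomial.C F := by
      refine Polynomial.eq_of_infinite_eval_eq _ _
        ((Set.infinite_range_of_injective (C_injective (σ × ι) K)).mono ?_)
      rintro _ ⟨c, rfl⟩
      simp [eval_genericTransvection, h]
    rw [← hzero (polarization σ K a b F), ← hderiv, hconst, Polynomial.derivative_C,
      Polynomial.eval_zero]
  · intro h c
    rw [h, map_zero] at hderiv
    have hconst := Polynomial.eq_C_of_derivative_eq_zero hderiv
    have hF := hzero F
    rw [hconst, Polynomial.eval_C] at hF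
    rw [← eval_genericTransvection, hconst, Polynomial.eval_C, hF]

end CommRing

theorem mem_sl2Invariants_iff [Field K] [CharZero K] {F : MvPolynomial (σ × Fin 2) K} :
    F ∈ sl2Invariants σ K ↔ ∀ g : SL(2, K), substMul (g : Matrix (Fin 2) (Fin 2) K) F = F := by
  constructor
  · rintro ⟨h01, h10⟩ g
    induction g using Matrix.SL2.transvection_induction with
    | hmul A B hA hB => rw [Matrix.SpecialLinearGroup.coe_mul, substMul_mul, hB, hA]
    | htransvec i j hij c =>
      refine (forall_substMul_transvection_eq_self_iff hij).2 ?_ c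
      fin_cases i <;> fin_cases j <;> simp_all
  · intro h
    have hpolarization {i j : Fin 2} (hij : i ≠ j) : polarization σ K i j F = 0 :=
      (forall_substMul_transvection_eq_self_iff hij).1 fun c =>
        h (Matrix.SpecialLinearGroup.transvection hij c)
    exact ⟨hpolarization zero_ne_one, hpolarization one_ne_zero⟩

end Substitution

section WeightedHomogeneous

open MvPolynomial

variable {σ τ ι M R : Type*} [CommSemiring R] [AddCommMonoid M]

theorem isWeightedHomogeneous_aeval {w : σ → M} {w' : τ → M} {f : σ → MvPolynomial τ R}
    (hf : ∀ i, IsWeightedHomogeneous w' (f i) (w i)) {F : MvPolynomial σ R} {m : M}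
    (hF : IsWeightedHomogeneous w F m) : IsWeightedHomogeneous w' (aeval f F) m := by
  rw [F.as_sum, map_sum]
  refine IsWeightedHomogeneous.sum _ _ _ fun d hd => ?_
  rw [← hF (mem_support_iff.1 hd), aeval_monomial, ← zero_add (Finsupp.weight w d)]
  refine (isWeightedHomogeneous_C w' _).mul ?_
  rw [Finsupp.weight_apply]
  exact IsWeightedHomogeneous.prod _ _ _ fun i _ => (hf i).pow (d i)

theorem weight_comp_fst (w : σ → M) (d : σ × ι →₀ ℕ) :
    Finsupp.weight (fun p => w p.1) d = Finsupp.weight w (rowDegree d) := by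
  induction d using Finsupp.induction_linear with
  | zero => simp
  | add d d' hd hd' => rw [map_add, map_add, map_add, hd, hd']
  | single p k => simp [rowDegree, Finsupp.weight_single]

theorem weightedHomogeneousSubmodule_comp_fst (w : σ → M) (m : M) :
    weightedHomogeneousSubmodule R (fun p : σ × ι => w p.1) m =
      restrictSupport R (rowDegree ⁻¹' {t | Finsupp.weight w t = m}) := by
  ext F
  simp only [mem_weightedHomogeneousSubmodule, IsWeightedHomogeneous, mem_restrictSupport_iff,
    Set.subset_def, Finset.mem_coe, mem_support_iff, weight_comp_fst, Set.mem_preimage,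
    Set.mem_ofPred_eq]

end WeightedHomogeneous

noncomputable section JointInvariants

open MvPolynomial

variable {n : ℕ}

theorem mem_jointInvariants_iff {F : MvPolynomial (Fin n × Fin 2) ℂ} :
    F ∈ jointInvariants n ↔ F ∈ sl2Invariants (Fin n) ℂ := by
  have heval (g : SL(2, ℂ)) (f : Fin n → LinearForm) :
      evalForms (fun i => (f i).act g) F =
        eval (fun p => f p.1 p.2) (substMul (↑g⁻¹ : Matrix (Fin 2) (Fin 2) ℂ) F) :=
    (eval_substMul (fun p => f p.1 p.2) _ F).symm
  rw [mem_sl2Invariants_iff, ← (Equiv.inv SL(2, ℂ)).forall_congr_right]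
  refine forall_congr' fun g => ?_
  simp only [heval, Equiv.inv_apply]
  exact ⟨fun h => MvPolynomial.funext fun x => h (Function.curry x), fun h f => by rw [h]; rfl⟩

theorem invariantsOfDegree_eq (n j : ℕ) :
    invariantsOfDegree n j =
      sl2Invariants (Fin n) ℂ ⊓ restrictSupport ℂ (rowDegree ⁻¹' {t | t.degree = j}) := by
  rw [Finsupp.degree_eq_weight_one, ← weightedHomogeneousSubmodule_comp_fst]
  exact Submodule.ext fun F => and_congr_left' mem_jointInvariants_iff

/-- The matrix with the coefficients of the `n` forms and of the form `det (v, ·)` as its rows. -/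
def formsVecRows (f : Fin n → LinearForm) (v : Fin 2 → ℂ) (p : Option (Fin n) × Fin 2) : ℂ :=
  p.1.elim ![-v 1, v 0] f p.2

theorem formsVecRows_act (g : SL(2, ℂ)) (f : Fin n → LinearForm) (v : Fin 2 → ℂ)
    (p : Option (Fin n) × Fin 2) :
    formsVecRows (fun i => (f i).act g) ((g : Matrix (Fin 2) (Fin 2) ℂ) *ᵥ v) p =
      ((fun a => formsVecRows f v (p.1, a)) ᵥ* (↑g⁻¹ : Matrix (Fin 2) (Fin 2) ℂ)) p.2 := by
  obtain ⟨_ | i, b⟩ := p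
  · fin_cases b <;>
      simp [formsVecRows, Matrix.SpecialLinearGroup.SL2_inv_expl, Matrix.vecMul, Matrix.mulVec,
        Matrix.vec2_dotProduct] <;> ring
  · rfl

variable (n) in
/-- The identification of `V₁` with `ℂ²` through the invariant `det`, which makes the polynomials
on `n V₁ ⊕ ℂ²` polynomials on `(n + 1) V₁`. -/
def vecToForm : MvPolynomial ((Fin n × Fin 2) ⊕ Fin 2) ℂ ≃ₐ[ℂ]
    MvPolynomial (Option (Fin n) × Fin 2) ℂ :=
  AlgEquiv.ofAlgHom
    (aeval (Sum.elim (fun p => X (some p.1, p.2)) ![X (none, 1), -X (none, 0)]))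
    (aeval fun p => p.1.elim ![-X (Sum.inr 1), X (Sum.inr 0)] (fun i a => X (Sum.inl (i, a))) p.2)
    (by ext ⟨_ | i, b⟩ <;> fin_cases b <;> simp)
    (by ext (⟨i, b⟩ | b) <;> fin_cases b <;> simp)

theorem eval_vecToForm (f : Fin n → LinearForm) (v : Fin 2 → ℂ)
    (F : MvPolynomial ((Fin n × Fin 2) ⊕ Fin 2) ℂ) :
    eval (formsVecRows f v) (vecToForm n F) = evalFormsVec f v F := by
  refine DFunLike.congr_fun (ringHom_ext
    (f := (eval (formsVecRows f v)).comp (vecToForm n).toRingHom) (fun r => ?_) fun p => ?_) F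
  · simp [vecToForm]
  · obtain ⟨i, b⟩ | b := p
    · simp [vecToForm, formsVecRows]
    · fin_cases b <;> simp [vecToForm, formsVecRows]

theorem vecToForm_mem_sl2Invariants_iff {F : MvPolynomial ((Fin n × Fin 2) ⊕ Fin 2) ℂ} :
    vecToForm n F ∈ sl2Invariants (Option (Fin n)) ℂ ↔ F ∈ jointCovariants n := by
  have heval (g : SL(2, ℂ)) (f : Fin n → LinearForm) (v : Fin 2 → ℂ) :
      evalFormsVec (fun i => (f i).act g) ((g : Matrix (Fin 2) (Fin 2) ℂ) *ᵥ v) F =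
        eval (formsVecRows f v) (substMul (↑g⁻¹ : Matrix (Fin 2) (Fin 2) ℂ) (vecToForm n F)) := by
    rw [eval_substMul, ← eval_vecToForm]
    exact congrArg (eval · _) (funext (formsVecRows_act g f v))
  have hrows (x : Option (Fin n) × Fin 2 → ℂ) :
      formsVecRows (fun i a => x (some i, a)) ![x (none, 1), -x (none, 0)] = x := by
    ext ⟨_ | i, b⟩ <;> fin_cases b <;> simp [formsVecRows]
  rw [mem_sl2Invariants_iff, ← (Equiv.inv SL(2, ℂ)).forall_congr_right]
  refine forall_congr' fun g => ?_
  simp only [heval, ← eval_vecToForm, Equiv.inv_apply]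
  exact ⟨fun h f v => by rw [h], fun h => MvPolynomial.funext fun x => hrows x ▸ h _ _⟩

theorem isWeightedHomogeneous_vecToForm_iff {F : MvPolynomial ((Fin n × Fin 2) ⊕ Fin 2) ℂ}
    {j : ℕ} :
    IsWeightedHomogeneous (fun p : Option (Fin n) × Fin 2 => p.1.elim 0 fun _ => 1)
        (vecToForm n F) j ↔
      IsWeightedHomogeneous (Sum.elim (fun _ => 1) (fun _ => 0)) F j := by
  refine ⟨fun h => ?_, isWeightedHomogeneous_aeval ?_⟩
  · rw [← (vecToForm n).symm_apply_apply F]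
    refine isWeightedHomogeneous_aeval ?_ h
    rintro ⟨_ | i, b⟩
    · fin_cases b
      · exact (isWeightedHomogeneous_X ℂ _ _).neg
      · exact isWeightedHomogeneous_X _ _ _
    · exact isWeightedHomogeneous_X _ _ _
  · rintro (⟨i, b⟩ | b)
    · exact isWeightedHomogeneous_X _ _ _
    · fin_cases b
      · exact isWeightedHomogeneous_X _ _ _
      · exact (isWeightedHomogeneous_X ℂ _ _).neg

theorem weight_option_elim {τ : Type*} (t : Option τ →₀ ℕ) :
    Finsupp.weight (fun i : Option τ => i.elim 0 fun _ => 1) t = t.some.degree := by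
  induction t using Finsupp.induction_linear with
  | zero => simp
  | add t t' ht ht' => rw [map_add, Finsupp.some_add, map_add, ht, ht']
  | single i k => cases i <;> simp [Finsupp.weight_single]

theorem map_vecToForm_covariantsOfDegree (n j : ℕ) :
    (covariantsOfDegree n j).map (vecToForm n).toLinearMap =
      sl2Invariants (Option (Fin n)) ℂ ⊓
        restrictSupport ℂ (rowDegree ⁻¹' {t | t.some.degree = j}) := by
  simp only [← weight_option_elim]
  rw [← weightedHomogeneousSubmodule_comp_fst]
  ext F
  obtain ⟨F, rfl⟩ := (vecToForm n).surjective F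
  exact ((vecToForm n).injective.mem_set_image (s := covariantsOfDegree n j)).trans
    (and_congr vecToForm_mem_sl2Invariants_iff isWeightedHomogeneous_vecToForm_iff).symm

end JointInvariants

section Counting

open MvPolynomial Module

theorem ncard_setOf_degree_eq {σ : Type*} [Fintype σ] (k : ℕ) :
    {u : σ →₀ ℕ | u.degree = k}.ncard = (Fintype.card σ).multichoose k := by
  classical
  rw [← Finset.card_univ, ← Finset.card_finsuppAntidiag_nat_eq_multichoose, ← Set.ncard_coe_finset]
  congr 1
  ext u
  simp [Finset.mem_finsuppAntidiag, Finsupp.degree_eq_sum]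

theorem ncard_setOf_degree_fst_eq_and_degree_snd_eq {σ : Type*} [Fintype σ] (k l : ℕ) :
    {p : (σ →₀ ℕ) × (σ →₀ ℕ) | p.1.degree = k ∧ p.2.degree = l}.ncard =
      (Fintype.card σ).multichoose k * (Fintype.card σ).multichoose l := by
  rw [← ncard_setOf_degree_eq, ← ncard_setOf_degree_eq, ← Set.ncard_prod]
  rfl

theorem ncard_eq_ncard_sep_not_le_add_ncard {α : Type*} [AddCommMonoid α] [PartialOrder α]
    [CanonicallyOrderedAdd α] [IsRightCancelAdd α] {A : Set α} (hA : A.Finite) (c : α) :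
    A.ncard = {p ∈ A | ¬ c ≤ p}.ncard + {p | p + c ∈ A}.ncard := by
  have hrange : (fun p => p + c) ⁻¹' (A ∩ {p | c ≤ p}) = {p | p + c ∈ A} := by
    ext p
    simp
  rw [← Set.ncard_inter_add_ncard_sdiff_eq_ncard A {p | c ≤ p} hA, add_comm, ← hrange,
    Set.ncard_preimage_of_injective_subset_range (add_left_injective c)]
  · rfl
  · rintro p ⟨-, hp⟩
    obtain ⟨q, rfl⟩ := le_iff_exists_add'.1 hp
    exact ⟨q, rfl⟩

/-- The pairs of multidegrees whose sum lies in `T`, where the first has total degree `k` more than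
the second one and does not involve `i`. -/
def pairsWithout {σ : Type*} (T : Set (σ →₀ ℕ)) (i : σ) (k : ℕ) : Set ((σ →₀ ℕ) × (σ →₀ ℕ)) :=
  {p | p.1 + p.2 ∈ T ∧ p.1.degree = p.2.degree + k ∧ p.1 i = 0}

theorem ncard_setOf_degree_fst_eq_degree_snd_add {σ : Type*} {T : Set (σ →₀ ℕ)} (hT : T.Finite)
    (i : σ) (k : ℕ) :
    {p : (σ →₀ ℕ) × (σ →₀ ℕ) | p.1 + p.2 ∈ T ∧ p.1.degree = p.2.degree + k}.ncard =
      (pairsWithout T i k).ncard +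
        {p : (σ →₀ ℕ) × (σ →₀ ℕ) | p.1 + p.2 + Finsupp.single i 1 ∈ T ∧
          p.1.degree + 1 = p.2.degree + k}.ncard := by
  rw [ncard_eq_ncard_sep_not_le_add_ncard
    ((finite_setOf_fst_add_snd_mem hT).subset fun _ hp => hp.1) (Finsupp.single i 1, 0)]
  congr 2 <;> ext ⟨u, v⟩
  · simp [pairsWithout, and_assoc]
  · simp [add_right_comm u]

variable {σ K : Type*} [Field K] [CharZero K]

/-- Swapping the columns matches the pairs for `0` and for `2` which are left over after removing
`i` once from the first multidegree. -/
theorem finrank_sl2Invariants_inf_restrictSupport_add_ncard_pairsWithout {T : Set (σ →₀ ℕ)}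
    (hT : T.Finite) (i : σ) :
    finrank K ↥(sl2Invariants σ K ⊓ restrictSupport K (rowDegree ⁻¹' T)) +
      (pairsWithout T i 2).ncard = (pairsWithout T i 0).ncard := by
  have : Nonempty σ := ⟨i⟩
  have hswap : {p : (σ →₀ ℕ) × (σ →₀ ℕ) | p.1 + p.2 + Finsupp.single i 1 ∈ T ∧
      p.1.degree + 1 = p.2.degree + 0}.ncard =
      {p : (σ →₀ ℕ) × (σ →₀ ℕ) | p.1 + p.2 + Finsupp.single i 1 ∈ T ∧
        p.1.degree + 1 = p.2.degree + 2}.ncard := by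
    rw [← Set.ncard_preimage_of_injective_subset_range Prod.swap_injective
      fun p _ => Prod.swap_surjective p]
    congr 1
    ext ⟨u, v⟩
    simp only [Set.mem_preimage, Set.mem_ofPred_eq, Prod.swap, add_comm v]
    exact and_congr_right fun _ => by omega
  have h := finrank_sl2Invariants_inf_restrictSupport (K := K) hT
  have h0 := ncard_setOf_degree_fst_eq_degree_snd_add hT i 0
  have h2 := ncard_setOf_degree_fst_eq_degree_snd_add hT i 2
  simp only [add_zero] at h0 hswap
  omega

variable {τ : Type*}

theorem degree_option (t : Option τ →₀ ℕ) : t.degree = t none + t.some.degree := by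
  induction t using Finsupp.induction_linear with
  | zero => simp
  | add t t' ht ht' =>
    rw [map_add, ht, ht', Finsupp.add_apply, Finsupp.some_add, map_add]
    abel
  | single i k => cases i <;> simp

theorem ncard_pairsWithout_none {j N : ℕ} (hjN : j ≤ N) (k : ℕ) :
    (pairsWithout {t : Option τ →₀ ℕ | t.some.degree = j ∧ t none ≤ N} none k).ncard =
      {p : (τ →₀ ℕ) × (τ →₀ ℕ) | p.1.degree + p.2.degree = j ∧
        p.2.degree + k ≤ p.1.degree}.ncard := by
  refine Set.ncard_congr (fun p _ => (p.1.some, p.2.some)) ?_ ?_ ?_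
  · rintro ⟨u, v⟩ ⟨⟨hj, -⟩, hdeg, hu⟩
    simp only [Set.mem_ofPred_eq, degree_option, Finsupp.some_add, map_add] at hj hdeg hu ⊢
    exact ⟨hj, by omega⟩
  · rintro ⟨u, v⟩ ⟨u', v'⟩ ⟨-, hdeg, hu⟩ ⟨-, hdeg', hu'⟩ h
    simp only [degree_option, Prod.mk.injEq] at hdeg hdeg' hu hu' h ⊢
    rw [h.1, h.2] at hdeg
    rw [← Finsupp.optionElim_some u, ← Finsupp.optionElim_some v, h.1, h.2, hu,
      show v none = v' none by omega, ← hu', Finsupp.optionElim_some, Finsupp.optionElim_some]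
    exact ⟨rfl, rfl⟩
  · rintro ⟨a, b⟩ ⟨hj, hdeg⟩
    change a.degree + b.degree = j at hj
    change b.degree + k ≤ a.degree at hdeg
    refine ⟨(Finsupp.optionElim 0 a, Finsupp.optionElim (a.degree - (b.degree + k)) b),
      ⟨⟨?_, ?_⟩, ?_, Finsupp.optionElim_apply_none _ _⟩, ?_⟩
    · rw [Finsupp.some_add, Finsupp.some_optionElim, Finsupp.some_optionElim, map_add, hj]
    · rw [Finsupp.add_apply, Finsupp.optionElim_apply_none, Finsupp.optionElim_apply_none]
      omega
    · rw [degree_option, degree_option, Finsupp.some_optionElim, Finsupp.some_optionElim,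
        Finsupp.optionElim_apply_none, Finsupp.optionElim_apply_none]
      omega
    · rw [Finsupp.some_optionElim, Finsupp.some_optionElim]

theorem finite_setOf_degree_some_eq_and_le [Finite τ] (j N : ℕ) :
    {t : Option τ →₀ ℕ | t.some.degree = j ∧ t none ≤ N}.Finite := by
  refine (Finsupp.finite_of_degree_le (j + N)).subset fun t ht => ?_
  rw [Set.mem_ofPred_eq] at ht ⊢
  rw [degree_option]
  omega

theorem finrank_sl2Invariants_option_of_le [Finite τ] {j N : ℕ} (hjN : j ≤ N) :
    finrank K ↥(sl2Invariants (Option τ) K ⊓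
        restrictSupport K (rowDegree ⁻¹' {t | t.some.degree = j ∧ t none ≤ N})) =
      {p : (τ →₀ ℕ) × (τ →₀ ℕ) | p.1.degree + p.2.degree = j ∧ p.2.degree ≤ p.1.degree ∧
        p.1.degree ≤ p.2.degree + 1}.ncard := by
  have h := finrank_sl2Invariants_inf_restrictSupport_add_ncard_pairsWithout (K := K)
    (finite_setOf_degree_some_eq_and_le (τ := τ) j N) none
  rw [ncard_pairsWithout_none hjN, ncard_pairsWithout_none hjN] at h
  have hfinite : {p : (τ →₀ ℕ) × (τ →₀ ℕ) | p.1.degree + p.2.degree = j ∧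
      p.2.degree + 0 ≤ p.1.degree}.Finite :=
    ((Finsupp.finite_of_degree_le j).prod (Finsupp.finite_of_degree_le j)).subset fun p hp =>
      ⟨Nat.le_of_add_right_le hp.1.le, Nat.le_of_add_left_le hp.1.le⟩
  have hinter : {p : (τ →₀ ℕ) × (τ →₀ ℕ) | p.1.degree + p.2.degree = j ∧
      p.2.degree + 0 ≤ p.1.degree} ∩ {p | p.2.degree + 2 ≤ p.1.degree} =
      {p | p.1.degree + p.2.degree = j ∧ p.2.degree + 2 ≤ p.1.degree} := by
    ext p
    simp only [Set.mem_inter_iff, Set.mem_ofPred_eq]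
    omega
  rw [← Set.ncard_inter_add_ncard_sdiff_eq_ncard _ {p | p.2.degree + 2 ≤ p.1.degree} hfinite,
    hinter, add_comm, Nat.add_left_cancel_iff] at h
  rw [h]
  congr 1
  ext p
  simp only [Set.mem_sdiff, Set.mem_ofPred_eq]
  omega

theorem sl2Invariants_option_inf_restrictSupport [Finite τ] (j : ℕ) :
    sl2Invariants (Option τ) K ⊓ restrictSupport K (rowDegree ⁻¹' {t | t.some.degree = j}) =
      sl2Invariants (Option τ) K ⊓
        restrictSupport K (rowDegree ⁻¹' {t | t.some.degree = j ∧ t none ≤ j}) := by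
  refine le_antisymm (fun F hF => ?_) ?_
  · -- Relaxing the bound `j` on the order does not increase the dimension.
    let N := j + F.support.sup fun d => rowDegree d none
    have hN : j ≤ N := Nat.le_add_right _ _
    have := finite_restrictSupport (R := K)
      (finite_rowDegree_preimage (finite_setOf_degree_some_eq_and_le (τ := τ) j N))
    have hmono : {t : Option τ →₀ ℕ | t.some.degree = j ∧ t none ≤ j} ⊆
        {t | t.some.degree = j ∧ t none ≤ N} := fun t ht => ⟨ht.1, ht.2.trans hN⟩
    have hstable := Submodule.eq_of_le_of_finrank_eq
      (inf_le_inf_left (sl2Invariants (Option τ) K)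
        (restrictSupport_mono K (Set.preimage_mono hmono)))
      ((finrank_sl2Invariants_option_of_le le_rfl).trans
        (finrank_sl2Invariants_option_of_le hN).symm)
    rw [hstable]
    refine ⟨hF.1, fun d hd => ⟨hF.2 hd, ?_⟩⟩
    exact (Finset.le_sup (f := fun d => rowDegree d none) hd).trans (Nat.le_add_left _ _)
  · exact inf_le_inf_left _ (restrictSupport_mono K fun _ hd => hd.1)

end Counting

section GradedDimensions

open MvPolynomial Module

theorem finite_setOf_degree_eq {σ : Type*} [Finite σ] (j : ℕ) :
    {t : σ →₀ ℕ | t.degree = j}.Finite :=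
  (Finsupp.finite_of_degree_le j).subset fun _ ht => ht.le

theorem finiteDimensional_invariantsOfDegree (n j : ℕ) :
    FiniteDimensional ℂ (invariantsOfDegree n j) := by
  have := finite_restrictSupport (R := ℂ)
    (finite_rowDegree_preimage (finite_setOf_degree_eq (σ := Fin n) j))
  rw [invariantsOfDegree_eq]
  exact Submodule.finiteDimensional_inf_right _ _

theorem finrank_invariantsOfDegree_add_ncard (n j : ℕ) :
    finrank ℂ (invariantsOfDegree (n + 1) j) +
        {p : (Fin (n + 1) →₀ ℕ) × (Fin (n + 1) →₀ ℕ) |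
          p.1.degree + p.2.degree = j ∧ p.1.degree = p.2.degree + 2}.ncard =
      {p : (Fin (n + 1) →₀ ℕ) × (Fin (n + 1) →₀ ℕ) |
        p.1.degree + p.2.degree = j ∧ p.1.degree = p.2.degree}.ncard := by
  rw [invariantsOfDegree_eq]
  simp only [← map_add]
  exact finrank_sl2Invariants_inf_restrictSupport (finite_setOf_degree_eq (σ := Fin (n + 1)) j)

theorem finrank_invariantsOfDegree_two_mul_add_one (n e : ℕ) :
    finrank ℂ (invariantsOfDegree (n + 1) (2 * e + 1)) = 0 := by
  have hempty : {p : (Fin (n + 1) →₀ ℕ) × (Fin (n + 1) →₀ ℕ) |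
      p.1.degree + p.2.degree = 2 * e + 1 ∧ p.1.degree = p.2.degree} = ∅ :=
    Set.eq_empty_of_forall_notMem fun p hp => by
      rw [Set.mem_ofPred_eq] at hp
      omega
  have h := finrank_invariantsOfDegree_add_ncard n (2 * e + 1)
  rw [hempty, Set.ncard_empty] at h
  exact Nat.eq_zero_of_add_eq_zero_right h

theorem ncard_setOf_degree_add_eq_and_degree_eq {σ : Type*} [Fintype σ] (e k : ℕ) :
    {p : (σ →₀ ℕ) × (σ →₀ ℕ) |
        p.1.degree + p.2.degree = 2 * e + k ∧ p.1.degree = p.2.degree + k}.ncard =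
      (Fintype.card σ).multichoose (e + k) * (Fintype.card σ).multichoose e := by
  rw [← ncard_setOf_degree_fst_eq_and_degree_snd_eq]
  congr 1
  ext p
  simp only [Set.mem_ofPred_eq]
  omega

theorem finrank_invariantsOfDegree_zero (n : ℕ) :
    finrank ℂ (invariantsOfDegree (n + 1) 0) = 1 := by
  have hempty : {p : (Fin (n + 1) →₀ ℕ) × (Fin (n + 1) →₀ ℕ) |
      p.1.degree + p.2.degree = 0 ∧ p.1.degree = p.2.degree + 2} = ∅ :=
    Set.eq_empty_of_forall_notMem fun p hp => by
      rw [Set.mem_ofPred_eq] at hp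
      omega
  have h := finrank_invariantsOfDegree_add_ncard n 0
  rw [hempty, Set.ncard_empty, add_zero] at h
  exact h.trans ((ncard_setOf_degree_add_eq_and_degree_eq (σ := Fin (n + 1)) 0 0).trans (by simp))

theorem finrank_invariantsOfDegree_two_mul_succ_add (n e : ℕ) :
    finrank ℂ (invariantsOfDegree (n + 1) (2 * (e + 1))) +
        (n + 1).multichoose (e + 2) * (n + 1).multichoose e =
      (n + 1).multichoose (e + 1) * (n + 1).multichoose (e + 1) := by
  have h0 := ncard_setOf_degree_add_eq_and_degree_eq (σ := Fin (n + 1)) (e + 1) 0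
  have h2 := ncard_setOf_degree_add_eq_and_degree_eq (σ := Fin (n + 1)) e 2
  rw [Fintype.card_fin] at h0 h2
  rw [← h2, ← h0]
  exact finrank_invariantsOfDegree_add_ncard n (2 * (e + 1))

theorem succ_mul_finrank_invariantsOfDegree_two_mul (n e : ℕ) :
    (e + 1) * finrank ℂ (invariantsOfDegree (n + 1) (2 * e)) =
      (n + 1).multichoose e * n.multichoose e := by
  cases e with
  | zero => simp [finrank_invariantsOfDegree_zero]
  | succ e =>
    have hfinrank := finrank_invariantsOfDegree_two_mul_succ_add n e
    have he := succ_mul_multichoose_succ (n + 1) e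
    have he' := succ_mul_multichoose_succ (n + 1) (e + 1)
    have hpascal := Nat.multichoose_succ_succ n e
    zify at hfinrank he he' hpascal ⊢
    linear_combination (e + 2 : ℤ) * hfinrank - (n + 1).multichoose e * he' +
      ((n + 1).multichoose (e + 1) : ℤ) * (he + hpascal)

theorem finiteDimensional_covariantsOfDegree (n j : ℕ) :
    FiniteDimensional ℂ (covariantsOfDegree n j) := by
  have := finite_restrictSupport (R := ℂ)
    (finite_rowDegree_preimage (finite_setOf_degree_some_eq_and_le (τ := Fin n) j j))
  have hfin : FiniteDimensional ℂ ↥((covariantsOfDegree n j).map (vecToForm n).toLinearMap) := by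
    rw [map_vecToForm_covariantsOfDegree, sl2Invariants_option_inf_restrictSupport]
    exact Submodule.finiteDimensional_inf_right _ _
  exact ((vecToForm n).toLinearEquiv.submoduleMap (covariantsOfDegree n j)).symm.finiteDimensional

theorem finrank_covariantsOfDegree (n j : ℕ) :
    finrank ℂ (covariantsOfDegree n j) =
      {p : (Fin n →₀ ℕ) × (Fin n →₀ ℕ) | p.1.degree + p.2.degree = j ∧
        p.2.degree ≤ p.1.degree ∧ p.1.degree ≤ p.2.degree + 1}.ncard := by
  rw [← finrank_sl2Invariants_option_of_le (K := ℂ) le_rfl,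
    ← sl2Invariants_option_inf_restrictSupport, ← map_vecToForm_covariantsOfDegree]
  exact ((vecToForm n).toLinearEquiv.finrank_map_eq _).symm

theorem finrank_covariantsOfDegree_two_mul (n e : ℕ) :
    finrank ℂ (covariantsOfDegree n (2 * e)) = n.multichoose e * n.multichoose e := by
  have h := ncard_setOf_degree_add_eq_and_degree_eq (σ := Fin n) e 0
  simp only [Fintype.card_fin, add_zero] at h
  rw [finrank_covariantsOfDegree, ← h]
  congr 1
  ext p
  simp only [Set.mem_ofPred_eq]
  omega

theorem finrank_covariantsOfDegree_two_mul_add_one (n e : ℕ) :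
    finrank ℂ (covariantsOfDegree n (2 * e + 1)) = n.multichoose (e + 1) * n.multichoose e := by
  have h := ncard_setOf_degree_add_eq_and_degree_eq (σ := Fin n) e 1
  rw [Fintype.card_fin] at h
  rw [finrank_covariantsOfDegree, ← h]
  congr 1
  ext p
  simp only [Set.mem_ofPred_eq]
  omega

end GradedDimensions

section Narayana

open PowerSeries

theorem evalSq_eq_expand (p : Polynomial ℚ) : evalSq p = expand 2 two_ne_zero (p : ℚ⟦X⟧) := by
  induction p using Polynomial.induction_on' with
  | add p q hp hq => rw [Polynomial.coe_add, map_add, ← hp, ← hq]; exact map_add _ _ _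
  | monomial k a =>
    have hmonomial : (monomial k a : ℚ⟦X⟧) = a • X ^ k := by
      rw [X_pow_eq, ← map_smul, smul_eq_mul, mul_one]
    rw [evalSq, Polynomial.aeval_monomial, Polynomial.coe_monomial, hmonomial, map_smul, map_pow,
      expand_X, Algebra.smul_def]

theorem narayana_succ (m : ℕ) :
    narayana (m + 1) = ∑ k ∈ Finset.range (m + 1),
      Polynomial.C ((m + 1).choose k * m.choose k / Nat.multichoose 2 k : ℚ) *
        Polynomial.X ^ k := by
  rw [narayana, ← Finset.Ico_add_one_right_eq_Icc, Finset.sum_Ico_eq_sum_range,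
    Nat.add_sub_cancel]
  refine Finset.sum_congr rfl fun k _ => ?_
  rw [Nat.multichoose_two, Nat.add_sub_cancel, Nat.add_sub_cancel_left, add_comm 1 k,
    mul_right_comm, mul_assoc, one_div_mul_eq_div]

theorem coe_sum_range_C_mul_X_pow {f : ℕ → ℚ} {m : ℕ} (hf : ∀ k, m < k → f k = 0) :
    ((∑ k ∈ Finset.range (m + 1), Polynomial.C (f k) * Polynomial.X ^ k : Polynomial ℚ) : ℚ⟦X⟧) =
      mk f := by
  ext k
  simp only [Polynomial.coeff_coe, coeff_mk, Polynomial.finsetSum_coeff,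
    Polynomial.coeff_C_mul_X_pow, Finset.sum_ite_eq, Finset.mem_range, Nat.lt_succ_iff]
  exact ite_eq_left_iff.2 fun h => (hf k (not_le.1 h)).symm

theorem coe_narayana_succ (m : ℕ) :
    (narayana (m + 1) : ℚ⟦X⟧) =
      mk fun k => ((m + 1).choose k * m.choose k / Nat.multichoose 2 k : ℚ) := by
  rw [narayana_succ, coe_sum_range_C_mul_X_pow fun k hk => ?_]
  rw [Nat.choose_eq_zero_of_lt hk, Nat.cast_zero, mul_zero, zero_div]

theorem coe_narayanaB (m : ℕ) :
    (narayanaB m : ℚ⟦X⟧) = mk fun k => (m.choose k * m.choose k / Nat.multichoose 1 k : ℚ) := by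
  rw [narayanaB, coe_sum_range_C_mul_X_pow fun k hk => ?_]
  · simp only [Nat.multichoose_one, Nat.cast_one, div_one, sq]
  · rw [Nat.choose_eq_zero_of_lt hk, Nat.cast_zero, zero_pow two_ne_zero]

theorem evalSq_C_mul_X_pow (a : ℚ) (k : ℕ) :
    evalSq (Polynomial.C a * Polynomial.X ^ k) = C a * X ^ (2 * k) := by
  rw [evalSq, map_mul, map_pow, Polynomial.aeval_C, Polynomial.aeval_X, ← pow_mul]
  rfl

theorem evalSq_narayana (m : ℕ) :
    evalSq (narayana m) = ∑ k ∈ Finset.Icc 1 m,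
      C ((1 / (k : ℚ)) * ((m - 1).choose (k - 1) : ℚ) * (m.choose (k - 1) : ℚ)) *
        (X : ℚ⟦X⟧) ^ (2 * k - 2) := by
  refine (map_sum _ _ _).trans (Finset.sum_congr rfl fun k _ => ?_)
  exact (evalSq_C_mul_X_pow _ _).trans (by rw [Nat.mul_sub])

theorem evalSq_narayanaB (m : ℕ) :
    evalSq (narayanaB m) =
      ∑ k ∈ Finset.range (m + 1), C ((m.choose k : ℚ) ^ 2) * (X : ℚ⟦X⟧) ^ (2 * k) :=
  (map_sum _ _ _).trans (Finset.sum_congr rfl fun _ _ => evalSq_C_mul_X_pow _ _)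

theorem natCast_mul_X_mul_evalSq_narayana (m : ℕ) :
    ((m + 2 : ℕ) : ℚ⟦X⟧) * X * evalSq (narayana (m + 1)) =
      ∑ k ∈ Finset.range (m + 1),
        C ((m.choose k : ℚ) * ((m + 2).choose (k + 1) : ℚ)) * (X : ℚ⟦X⟧) ^ (2 * k + 1) := by
  have hcoeff (k : ℕ) : (m.choose k : ℚ) * (m + 2).choose (k + 1) =
      (m + 2 : ℕ) * ((m + 1).choose k * m.choose k / Nat.multichoose 2 k) := by
    have h : ((m + 2 : ℕ) : ℚ) * (m + 1).choose k = (m + 2).choose (k + 1) * (k + 1) :=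
      mod_cast Nat.add_one_mul_choose_eq (m + 1) k
    rw [Nat.multichoose_two]
    push_cast at h ⊢
    field_simp
    linear_combination -(m.choose k : ℚ) * h
  have hsum : evalSq (narayana (m + 1)) = _ := (congrArg evalSq (narayana_succ m)).trans
    ((map_sum _ _ _).trans (Finset.sum_congr rfl fun _ _ => evalSq_C_mul_X_pow _ _))
  rw [hsum, Finset.mul_sum]
  refine Finset.sum_congr rfl fun k _ => ?_
  rw [hcoeff, map_mul, map_natCast, pow_succ]
  ring

end Narayana

section PoincareSeries

open PowerSeries

theorem poincareSeries_invariantsOfDegree_succ (n : ℕ) :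
    poincareSeries (invariantsOfDegree (n + 1)) = expand 2 two_ne_zero
      (mk fun e => ((n + 1).multichoose e * n.multichoose e / Nat.multichoose 2 e : ℚ)) := by
  ext j
  rw [poincareSeries, coeff_mk]
  obtain ⟨e, rfl | rfl⟩ := Nat.even_or_odd' j
  · rw [coeff_expand_mul, coeff_mk, Nat.multichoose_two, eq_div_iff (by positivity), mul_comm]
    exact_mod_cast succ_mul_finrank_invariantsOfDegree_two_mul n e
  · rw [finrank_invariantsOfDegree_two_mul_add_one, coeff_expand_of_not_dvd _ _ _ (by omega),
      Nat.cast_zero]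

theorem poincareSeries_covariantsOfDegree (n : ℕ) :
    poincareSeries (covariantsOfDegree n) =
      expand 2 two_ne_zero
          (mk fun e => (n.multichoose e * n.multichoose e / Nat.multichoose 1 e : ℚ)) +
        (n : ℚ⟦X⟧) * X * poincareSeries (invariantsOfDegree (n + 1)) := by
  rw [poincareSeries_invariantsOfDegree_succ, mul_assoc, ← map_natCast (C (R := ℚ))]
  ext j
  rw [poincareSeries, coeff_mk, map_add, coeff_C_mul]
  obtain ⟨e, rfl | rfl⟩ := Nat.even_or_odd' j
  · have hodd (F : ℚ⟦X⟧) : coeff (2 * e) (X * expand 2 two_ne_zero F) = 0 := by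
      cases e with
      | zero => simp
      | succ e => rw [Nat.mul_succ, coeff_succ_X_mul, coeff_expand_of_not_dvd _ _ _ (by omega)]
    rw [hodd, coeff_expand_mul, coeff_mk, finrank_covariantsOfDegree_two_mul, Nat.multichoose_one]
    push_cast
    ring
  · rw [coeff_expand_of_not_dvd _ _ _ (by omega), coeff_succ_X_mul, coeff_expand_mul, coeff_mk,
      finrank_covariantsOfDegree_two_mul_add_one, Nat.multichoose_two]
    have h := (succ_mul_multichoose_succ n e).trans (mul_multichoose_succ_left n e).symm
    have h' := congrArg (Nat.cast (R := ℚ)) h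
    push_cast at h' ⊢
    field_simp
    linear_combination (n.multichoose e : ℚ) * h'

theorem expand_mul_one_sub_X_sq_pow {F G : ℚ⟦X⟧} {N : ℕ} (h : F * (1 - X) ^ N = G) :
    expand 2 two_ne_zero F * (1 - X ^ 2) ^ N = expand 2 two_ne_zero G := by
  rw [← h, map_mul, map_pow, map_sub, map_one, expand_X]

theorem poincareSeries_invariantsOfDegree_mul_pow (m : ℕ) :
    poincareSeries (invariantsOfDegree (m + 3)) * (1 - X ^ 2) ^ (2 * m + 3) =
      evalSq (narayana (m + 1)) := by
  rw [poincareSeries_invariantsOfDegree_succ, evalSq_eq_expand, coe_narayana_succ,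
    ← mk_multichoose_mul_one_sub_X_pow_eq_mk_choose two_pos]
  refine expand_mul_one_sub_X_sq_pow ?_
  congr 2
  ring

theorem poincareSeries_covariantsOfDegree_mul_pow (m : ℕ) :
    poincareSeries (covariantsOfDegree (m + 2)) * (1 - X ^ 2) ^ (2 * m + 3) =
      evalSq (narayanaB (m + 1)) +
        ((m + 2 : ℕ) : ℚ⟦X⟧) * X * evalSq (narayana (m + 1)) := by
  rw [poincareSeries_covariantsOfDegree, add_mul, mul_assoc _ (poincareSeries _),
    poincareSeries_invariantsOfDegree_mul_pow, evalSq_eq_expand (narayanaB _), coe_narayanaB,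
    ← mk_multichoose_mul_one_sub_X_pow_eq_mk_choose one_pos]
  congr 1
  refine expand_mul_one_sub_X_sq_pow ?_
  congr 2
  ring

end PoincareSeries

end BinaryForms

theorem theorem1 (n : ℕ) :
    -- all graded components are finite-dimensional
    (∀ j : ℕ, FiniteDimensional ℂ (BinaryForms.invariantsOfDegree n j)) ∧
    (∀ j : ℕ, FiniteDimensional ℂ (BinaryForms.covariantsOfDegree n j)) ∧
    -- (i), with explicit coefficients and through the Narayana polynomial
    (3 ≤ n →
      BinaryForms.poincareSeries (BinaryForms.invariantsOfDegree n) =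
        (∑ k ∈ Finset.Icc 1 (n - 2),
          PowerSeries.C ((1 / (k : ℚ)) * ((n - 3).choose (k - 1) : ℚ) *
            ((n - 2).choose (k - 1) : ℚ)) * (PowerSeries.X : PowerSeries ℚ) ^ (2 * k - 2)) *
          ((1 - (PowerSeries.X : PowerSeries ℚ) ^ 2) ^ (2 * n - 3))⁻¹ ∧
      BinaryForms.poincareSeries (BinaryForms.invariantsOfDegree n) =
        BinaryForms.evalSq (BinaryForms.narayana (n - 2)) *
          ((1 - (PowerSeries.X : PowerSeries ℚ) ^ 2) ^ (2 * n - 3))⁻¹) ∧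
    -- (ii), with explicit coefficients and through the Narayana polynomials
    (2 ≤ n →
      BinaryForms.poincareSeries (BinaryForms.covariantsOfDegree n) =
        ((∑ k ∈ Finset.range n,
            PowerSeries.C (((n - 1).choose k : ℚ) ^ 2) *
              (PowerSeries.X : PowerSeries ℚ) ^ (2 * k)) +
          ∑ k ∈ Finset.range (n - 1),
            PowerSeries.C (((n - 2).choose k : ℚ) * (n.choose (k + 1) : ℚ)) *
              (PowerSeries.X : PowerSeries ℚ) ^ (2 * k + 1)) *
          ((1 - (PowerSeries.X : PowerSeries ℚ) ^ 2) ^ (2 * n - 1))⁻¹ ∧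
      BinaryForms.poincareSeries (BinaryForms.covariantsOfDegree n) =
        (BinaryForms.evalSq (BinaryForms.narayanaB (n - 1)) +
          (n : PowerSeries ℚ) * PowerSeries.X *
            BinaryForms.evalSq (BinaryForms.narayana (n - 1))) *
          ((1 - (PowerSeries.X : PowerSeries ℚ) ^ 2) ^ (2 * n - 1))⁻¹) := by
  refine ⟨BinaryForms.finiteDimensional_invariantsOfDegree n,
    BinaryForms.finiteDimensional_covariantsOfDegree n, fun hn => ?_, fun hn => ?_⟩
  · obtain ⟨m, rfl⟩ := Nat.exists_eq_add_of_le' hn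
    have h := (PowerSeries.eq_mul_inv_iff_mul_eq (by simp)).2
      (BinaryForms.poincareSeries_invariantsOfDegree_mul_pow m)
    rw [show 2 * (m + 3) - 3 = 2 * m + 3 by omega, show m + 3 - 2 = m + 1 by omega]
    exact ⟨by rw [h, BinaryForms.evalSq_narayana]; rfl, h⟩
  · obtain ⟨m, rfl⟩ := Nat.exists_eq_add_of_le' hn
    have h := (PowerSeries.eq_mul_inv_iff_mul_eq (by simp)).2
      (BinaryForms.poincareSeries_covariantsOfDegree_mul_pow m)
    rw [show 2 * (m + 2) - 1 = 2 * m + 3 by omega, show m + 2 - 1 = m + 1 by omega]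
    refine ⟨?_, h⟩
    rw [h, BinaryForms.evalSq_narayanaB, BinaryForms.natCast_mul_X_mul_evalSq_narayana]
    rfl
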